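/- Let $H$ be a finite simple graph with two disjoint distinguished vertex sets $U=\{u_1,\dots,u_x\}$ and $V=\{v_1,\dots,v_y\}$ (each listed in a fixed order), such that every vertex of $H$ outside $U\cup V$ has degree at least $1$. Put $t=|V(H)|$, $z=|V(H)\setminus(U\cup V)|$, and let $q$ be the minimum size of a vertex separator of $U$ and $V$, that is, of a set $S\subseteq V(H)$ (possibly meeting $U\cup V$) that intersects every path from $U$ to $V$. Let $n\ge 1$. For a graph $G$ on $[n]=\{1,\dots,n\}$ and a pair $e$ of distinct vertices let $\chi_e(G)=1$ if $e\in E(G)$ and $\chi_e(G)=-1$ otherwise. Let $R_H=R_H(G)$ be the $\binom nx\times\binom ny$ matrix, with rows and columns indexed by the subsets $A=\{a_1<\dots<a_x\}$ and $B=\{b_1<\dots<b_y\}$ of $[n]$, with entries $$R_H(A,B)=\sum_{\pi}\ \prod_{\{a,b\}\in E(H)}\chi_{\{\pi(a),\pi(b)\}}(G),$$ where $\pi$ runs over all injective maps $V(H)\to[n]$ with $\pi(u_i)=a_i$ for all $i$ and $\pi(v_j)=b_j$ for all $j$ (so $R_H(A,B)=0$ if $A\cap B\ne\emptyset$). Let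 $\|\cdot\|$ denote the operator norm with respect to the Euclidean norms. 1. If $q+z\ge 1$, then for every $\varepsilon\in(0,1)$ and for $G\sim G(n,\tfrac12)$, $$\mathbb P\left[\|R_H\|\ \ge\ 2\,t^t\left(e(t+z)\left(\frac{\ln(8n^q/\varepsilon)}{2(q+z)}+1\right)\right)^{q+z}n^{\frac{t-q}{2}}\right]\le\varepsilon .$$ 2. If $q=z=0$, then $\|R_H\|\le n^{t/2}$ for every graph $G$ on $[n]$. -/

import Mathlib

open scoped Matrix.Norms.L2Operator

namespace GraphMatrix

/-- The edge variable of a possible edge `e` of the input graph `G`: `1` if `e` is an edge of `G`,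
and `-1` otherwise. -/
noncomputable def edgeVar {n : ℕ} (G : SimpleGraph (Fin n)) (e : Sym2 (Fin n)) : ℝ :=
  open Classical in if e ∈ G.edgeSet then 1 else -1

/-- The Fourier character `χ_E`, the product of the edge variables of the edges in `E`. -/
noncomputable def chi {n : ℕ} (G : SimpleGraph (Fin n)) (E : Finset (Sym2 (Fin n))) : ℝ :=
  ∏ e ∈ E, edgeVar G e

/-- The image `π(E(H))` of the edge set of `H` under a map `π : V(H) → [n]`. -/
def mapEdges {α : Type*} [Fintype α] [DecidableEq α] (H : SimpleGraph α) [DecidableRel H.Adj]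
    {n : ℕ} (π : α → Fin n) : Finset (Sym2 (Fin n)) :=
  H.edgeFinset.image (Sym2.map π)

/-- The index set of rows (or columns): the `x`-element subsets of the vertex set `[n]` of `G`. -/
abbrev Idx (n x : ℕ) : Type := {A : Finset (Fin n) // A.card = x}

/-- The `i`-th element of `A`, in increasing order. -/
def Idx.elem {n x : ℕ} (A : Idx n x) (i : Fin x) : Fin n := A.1.orderEmbOfFin A.2 i

/-- The matrix `R_H`, as a function of the input graph `G`. Here `u` and `v` list, without
repetition, the two distinguished vertex sets `U = {u_1, …, u_x}` and `V = {v_1, …, v_y}` of `H`.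

The entry at `(A, B)` is the sum of `χ_{π(E(H))}` over all injective maps `π : V(H) → [n]` with
`π(u_i) = a_i` and `π(v_j) = b_j` for all `i`, `j`. Such maps `π` correspond to the ordered tuples
`C` of distinct elements outside `A ∪ B` indexed by the vertices of `H` outside `U ∪ V`; there are
none, so the entry is `0`, unless (`a_i = b_j` if and only if `u_i = v_j`) for all `i`, `j`. -/
noncomputable def R {α : Type*} [Fintype α] [DecidableEq α] (H : SimpleGraph α)
    [DecidableRel H.Adj] {x y : ℕ} (u : Fin x ↪ α) (v : Fin y ↪ α) {n : ℕ}
    (G : SimpleGraph (Fin n)) : Matrix (Idx n x) (Idx n y) ℝ :=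
  Matrix.of fun A B =>
    ∑ π : α ↪ Fin n with (∀ i, π (u i) = A.elem i) ∧ (∀ j, π (v j) = B.elem j),
      chi G (mapEdges H π)

/-- `S` is a vertex separator of `U` and `V`: every path from `U` to `V` meets `S`. -/
def IsSeparator {α : Type*} (H : SimpleGraph α) (U V : Set α) (S : Finset α) : Prop :=
  ∀ a ∈ U, ∀ b ∈ V, ∀ p : H.Walk a b, p.IsPath → ∃ s ∈ S, s ∈ p.support

/-- The minimal size of a vertex separator of `U` and `V`. -/
noncomputable def minSeparator {α : Type*} (H : SimpleGraph α) (U V : Set α) : ℕ :=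
  sInf {m | ∃ S : Finset α, IsSeparator H U V S ∧ S.card = m}

/-- The edge probability `1/2`. -/
noncomputable def half : unitInterval := ⟨1 / 2, by norm_num, by norm_num⟩

end GraphMatrix

/-! The proof is a moment method: `‖M‖ ^ (2k) ≤ tr ((M Mᵀ) ^ k)`, averaged over all graphs and
followed by Markov's inequality. The trace expands into closed sequences of `2k` maps `V(H) → [n]`,
consecutive ones agreeing on `U` or on `V`. Toggling an edge variable that occurs exactly once flips
the sign of the term, so in every term with nonzero mean each edge occurs at least twice.

To control repetitions, `R` is first replaced by colour-coded pieces: a colouring `f : [n] → V(H)`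
keeps only the maps having `f` as a left inverse. Images of different vertices of `H` then never
collide, and a repeated edge comes from the same edge of `H`. Averaging over colourings costs the
factor `t ^ t`.

Let `c w ≤ k` be the number of values taken at `w` in a surviving term. Along a `U`-`V` path with
`ℓ` edges the values form a connected graph with at most `kℓ` edges, hence number at most `kℓ + 1`;
so the deficits `k - c w` sum to at least `k - 1` on every such path. A Menger-type duality
(`mul_minSeparator_le`) makes the total deficit at least `(k - 1) q`, so at most `kt - (k - 1) q`
values occur. Counting functions with so small an image bounds the moment
(`sum_norm_coloredR_pow_le`), and `k` about `log (n ^ q / ε) / (2 (q + z))` finishes. If `q = z =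
0`, the Frobenius norm suffices. -/

namespace GraphMatrix

/-! ### Operator norm, traces of powers and closed paths -/

theorem norm_pow_two_mul_le_trace {I J : Type*} [Fintype I] [DecidableEq I] [Fintype J]
    [DecidableEq J] (A : Matrix I J ℝ) {k : ℕ} (hk : k ≠ 0) :
    ‖A‖ ^ (2 * k) ≤ ((A * A.transpose) ^ k).trace := by
  have hnorm : ‖A‖ ^ 2 = ‖A * A.transpose‖ := by
    have h := Matrix.l2_opNorm_conjTranspose_mul_self A.conjTranspose
    rw [Matrix.conjTranspose_conjTranspose, Matrix.l2_opNorm_conjTranspose,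
      Matrix.conjTranspose_eq_transpose_of_trivial] at h
    rw [h, sq]
  have hpsd : (A * A.transpose).PosSemidef := by
    simpa [Matrix.conjTranspose_eq_transpose_of_trivial] using
      Matrix.posSemidef_self_mul_conjTranspose A
  set M := A * A.transpose with hM
  have hH := hpsd.isHermitian
  have hnn : ∀ i, 0 ≤ hH.eigenvalues i := fun i => hpsd.eigenvalues_nonneg i
  have hspec := hH.spectral_theorem
  have htr : (M ^ k).trace = ∑ i, hH.eigenvalues i ^ k := by
    conv_lhs => rw [hspec]
    rw [← map_pow, Matrix.diagonal_pow, Unitary.conjStarAlgAut_apply, Matrix.trace_mul_cycle]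
    simp [Matrix.trace]
  have hMn : ‖M‖ = ‖hH.eigenvalues‖ := by
    conv_lhs => rw [hspec]
    rw [Unitary.conjStarAlgAut_apply, CStarRing.norm_mul_mem_unitary _ (Unitary.star_mem
      hH.eigenvectorUnitary.2), CStarRing.norm_mem_unitary_mul _ hH.eigenvectorUnitary.2,
      Matrix.l2_opNorm_diagonal]
    rfl
  rw [pow_mul, hnorm, hMn, htr]
  rcases isEmpty_or_nonempty I with hI | hI
  · have : ‖hH.eigenvalues‖ = 0 := by
      rw [norm_eq_zero]; exact Subsingleton.elim _ _
    rw [this, zero_pow hk]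
    exact Finset.sum_nonneg fun i _ => pow_nonneg (hnn i) k
  · obtain ⟨i, -, hi⟩ := Finset.exists_max_image Finset.univ hH.eigenvalues Finset.univ_nonempty
    have : ‖hH.eigenvalues‖ ≤ hH.eigenvalues i := by
      rw [pi_norm_le_iff_of_nonneg (hnn i)]
      intro j
      rw [Real.norm_of_nonneg (hnn j)]
      exact hi j (Finset.mem_univ j)
    calc ‖hH.eigenvalues‖ ^ k ≤ hH.eigenvalues i ^ k := by gcongr
      _ ≤ _ := Finset.single_le_sum (f := fun i => hH.eigenvalues i ^ k)
        (fun j _ => pow_nonneg (hnn j) k) (Finset.mem_univ i)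

theorem pow_apply_eq_sum_path {I : Type*} [Fintype I] [DecidableEq I] {S : Type*} [CommRing S]
    (M : Matrix I I S) (k : ℕ) (i j : I) :
    (M ^ k) i j = ∑ p : Fin (k + 1) → I with p 0 = i ∧ p (Fin.last k) = j,
      ∏ m : Fin k, M (p m.castSucc) (p m.succ) := by
  induction k generalizing i with
  | zero =>
    rw [Finset.sum_filter, ← (Equiv.funUnique (Fin 1) I).symm.sum_comp]
    simp only [pow_zero, Matrix.one_apply, Finset.univ_eq_empty, Finset.prod_empty]
    by_cases h : i = j
    · subst h
      simp [Equiv.funUnique]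
    · have : ∀ x : I, ¬ (x = i ∧ x = j) := fun x hx => h (hx.1.symm.trans hx.2)
      simp [Equiv.funUnique, h, this]
  | succ k ih =>
    rw [pow_succ', Matrix.mul_apply, Finset.sum_filter, ← (Fin.consEquiv fun _ => I).sum_comp,
      Fintype.sum_prod_type]
    symm
    rw [Finset.sum_eq_single i]
    · simp only [ih, Finset.sum_filter, Finset.mul_sum]
      rw [Finset.sum_comm]
      refine Finset.sum_congr rfl fun p _ => ?_
      rw [Finset.sum_eq_single (p 0)]
      · simp [Fin.consEquiv, Fin.prod_univ_succ, ← Fin.succ_last]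
      · intro b _ hb; simp [hb.symm]
      · simp
    · intro b _ hb
      refine Finset.sum_eq_zero fun p _ => ?_
      simp [Fin.consEquiv, hb]
    · simp

theorem trace_pow_eq_sum_closed_path {I : Type*} [Fintype I] [DecidableEq I] {S : Type*}
    [CommRing S] (M : Matrix I I S) (k : ℕ) :
    (M ^ k).trace = ∑ p : Fin (k + 1) → I with p 0 = p (Fin.last k),
      ∏ m : Fin k, M (p m.castSucc) (p m.succ) := by
  simp only [Matrix.trace, Matrix.diag, pow_apply_eq_sum_path, Finset.sum_filter]
  rw [Finset.sum_comm]
  refine Finset.sum_congr rfl fun p _ => ?_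
  rw [Finset.sum_eq_single (p 0)]
  · simp [eq_comm]
  · intro b _ hb; simp [hb.symm]
  · simp

/-! ### Counting functions with small image -/

/-- Such a function has `m` positions whose values are copied from positions outside these `m`.
Naming the `m` positions and their sources costs `|σ| ^ (2m)`; the remaining `|σ| - m` values are
free. -/
theorem card_image_card_add_le {σ β : Type*} [Fintype σ] [DecidableEq σ] [Fintype β]
    [DecidableEq β] (m : ℕ) :
    (Finset.univ.filter fun g : σ → β => (Finset.univ.image g).card + m ≤ Fintype.card σ).card ≤
      Fintype.card σ ^ (2 * m) * Fintype.card β ^ (Fintype.card σ - m) := by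
  classical
  let F : (Fin m → σ) × (Fin m → σ) → Finset (σ → β) := fun ep =>
    if Function.Injective ep.1 ∧ ∀ i j, ep.2 i ≠ ep.1 j then
      Finset.univ.filter fun g => ∀ i, g (ep.1 i) = g (ep.2 i) else ∅
  have hF : ∀ ep, (F ep).card ≤ Fintype.card β ^ (Fintype.card σ - m) := by
    rintro ⟨e, p⟩
    by_cases h : Function.Injective e ∧ ∀ i j, p i ≠ e j
    · simp only [F, if_pos h]
      have hc : Fintype.card {s // s ∉ Set.range e} = Fintype.card σ - m := by
        rw [Fintype.card_subtype_compl, ← Set.toFinset_card, Set.toFinset_range,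
          Finset.card_image_of_injective _ h.1]
        simp
      rw [← hc, ← Fintype.card_fun, ← Finset.card_univ]
      refine Finset.card_le_card_of_injOn (fun g s => g s.1) (fun _ _ => Finset.mem_univ _) ?_
      intro g hg g' hg' heq
      simp only [Finset.coe_filter, Finset.mem_univ, true_and, Set.mem_ofPred_eq] at hg hg'
      have hout : ∀ s, s ∉ Set.range e → g s = g' s := fun s hs => congrFun heq ⟨s, hs⟩
      funext s
      by_cases hs : s ∈ Set.range e
      · obtain ⟨i, rfl⟩ := hs
        rw [hg, hg']
        exact hout _ (by rintro ⟨j, hj⟩; exact h.2 i j hj.symm)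
      · exact hout s hs
    · simp [F, if_neg h]
  have hsub : (Finset.univ.filter fun g : σ → β =>
      (Finset.univ.image g).card + m ≤ Fintype.card σ) ⊆ Finset.univ.biUnion F := by
    intro g hg
    simp only [Finset.mem_filter, Finset.mem_univ, true_and] at hg
    -- `r` picks one representative in each fibre of `g`; every position outside its range copies
    -- its value from a representative.
    let r : σ → σ := fun s => (Quotient.mk (Setoid.ker g) s).out
    have hr : ∀ s, g (r s) = g s := fun s => Quotient.mk_out (s := Setoid.ker g) s
    have hrr : ∀ s s', g s = g s' → r s = r s' := fun s s' h =>
      congrArg Quotient.out (Quotient.sound (s := Setoid.ker g) h)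
    have hT : (Finset.univ.image r).card ≤ (Finset.univ.image g).card := by
      refine Finset.card_le_card_of_injOn g (fun s _ => by simp) ?_
      intro s hs s' hs' heq
      simp only [Finset.coe_image, Finset.coe_univ, Set.image_univ, Set.mem_range] at hs hs'
      obtain ⟨a, rfl⟩ := hs
      obtain ⟨b, rfl⟩ := hs'
      rw [hr, hr] at heq
      exact hrr _ _ heq
    have hTc : m ≤ (Finset.univ.image r)ᶜ.card := by
      rw [Finset.card_compl]; omega
    obtain ⟨S, hS, hSm⟩ := Finset.exists_subset_card_eq hTc
    let e : Fin m ≃ S := (Fintype.equivFinOfCardEq (by simpa using hSm)).symm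
    simp only [Finset.mem_biUnion, Finset.mem_univ, true_and, F]
    refine ⟨⟨fun i => e i, fun i => r (e i)⟩, ?_⟩
    rw [if_pos]
    · simp [hr]
    · refine ⟨Subtype.val_injective.comp e.injective, fun i j h => ?_⟩
      dsimp only at h
      have := hS (e j).2
      rw [← h] at this
      simp at this
  calc _ ≤ (Finset.univ.biUnion F).card := Finset.card_le_card hsub
    _ ≤ ∑ ep, (F ep).card := Finset.card_biUnion_le
    _ ≤ ∑ _ep : (Fin m → σ) × (Fin m → σ), Fintype.card β ^ (Fintype.card σ - m) :=
      Finset.sum_le_sum fun ep _ => hF ep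
    _ = _ := by
      simp [Fintype.card_prod, two_mul, pow_add]

/-! ### Separators and weighted paths -/

/-- Easy half of a weighted max-flow argument: with `d` the weighted distance from `U`, each level
`θ = 1, …, K` cuts out a separator, namely the vertices whose interval `(d w - c w, d w]` contains
`θ`. A vertex `w` lies in at most `c w` of these `K` separators. -/
theorem mul_minSeparator_le {α : Type*} [Fintype α] [DecidableEq α] (H : SimpleGraph α)
    (U V : Set α) (c : α → ℕ) (K : ℕ)
    (hpath : ∀ a ∈ U, ∀ b ∈ V, ∀ p : H.Walk a b, p.IsPath → K ≤ ∑ w ∈ p.support.toFinset, c w) :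
    K * minSeparator H U V ≤ ∑ w, c w := by
  let D : α → Set ℕ := fun w =>
    {m | ∃ a ∈ U, ∃ p : H.Walk a w, ∑ x ∈ p.support.toFinset, c x = m}
  -- A vertex not reachable from `U` gets the default distance `0`, hence lies in no `S θ` with `θ ≥
  -- 1`. The nonemptiness hypotheses below exclude this default.
  let d : α → ℕ := fun w => sInf (D w)
  let S : ℕ → Finset α := fun θ => Finset.univ.filter fun w => θ ≤ d w ∧ d w < θ + c w
  have hstep : ∀ w w', H.Adj w w' → (D w).Nonempty → (D w').Nonempty ∧ d w' ≤ d w + c w' := by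
    intro w w' hadj hne
    obtain ⟨a, ha, p, hp⟩ := Nat.sInf_mem hne
    have hmem : ∑ x ∈ (p.concat hadj).support.toFinset, c x ∈ D w' := ⟨a, ha, _, rfl⟩
    refine ⟨⟨_, hmem⟩, (Nat.sInf_le hmem).trans ?_⟩
    have hsub : (p.concat hadj).support.toFinset ⊆ insert w' p.support.toFinset := by
      intro x
      simp [SimpleGraph.Walk.support_concat]
    refine (Finset.sum_le_sum_of_subset hsub).trans ?_
    by_cases h : w' ∈ p.support.toFinset
    · rw [Finset.insert_eq_of_mem h, hp]; exact Nat.le_add_right _ _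
    · rw [Finset.sum_insert h, hp, add_comm]
  have hstart : ∀ a ∈ U, (D a).Nonempty ∧ d a ≤ c a := by
    intro a ha
    have hmem : ∑ x ∈ (SimpleGraph.Walk.nil : H.Walk a a).support.toFinset, c x ∈ D a :=
      ⟨a, ha, _, rfl⟩
    exact ⟨⟨_, hmem⟩, (Nat.sInf_le hmem).trans (by simp)⟩
  have hend : ∀ b ∈ V, (D b).Nonempty → K ≤ d b := by
    intro b hb hne
    obtain ⟨a, ha, p, hp⟩ := Nat.sInf_mem hne
    refine (hpath a ha b hb p.bypass p.bypass_isPath).trans ?_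
    change _ ≤ sInf (D b)
    rw [← hp]
    refine Finset.sum_le_sum_of_subset fun x hx => ?_
    rw [List.mem_toFinset] at hx ⊢
    exact p.support_bypass_subset_support hx
  have hwalk : ∀ θ ≤ K, ∀ a b, ∀ p : H.Walk a b, b ∈ V → (D a).Nonempty → d a < θ + c a →
      ∃ s ∈ S θ, s ∈ p.support := by
    intro θ hθ a b p hb
    induction p with
    | @nil a =>
      intro hne hlt
      exact ⟨a, by simp [S, hlt, hθ.trans (hend _ hb hne)], by simp⟩
    | @cons a a' b hadj p ih =>
      intro hne hlt
      by_cases h : θ ≤ d a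
      · exact ⟨a, by simp [S, hlt, h], by simp⟩
      · obtain ⟨hne', hle⟩ := hstep a a' hadj hne
        obtain ⟨s, hs, hsp⟩ := ih hb hne' (by omega)
        exact ⟨s, hs, by simp [hsp]⟩
  have hsep : ∀ θ ∈ Finset.Icc 1 K, minSeparator H U V ≤ (S θ).card := by
    intro θ hθ
    rw [Finset.mem_Icc] at hθ
    refine Nat.sInf_le ⟨S θ, fun a ha b hb p _ => ?_, rfl⟩
    obtain ⟨hne, hle⟩ := hstart a ha
    exact hwalk θ hθ.2 a b p hb hne (by omega)
  calc K * minSeparator H U V = ∑ _θ ∈ Finset.Icc 1 K, minSeparator H U V := by simp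
    _ ≤ ∑ θ ∈ Finset.Icc 1 K, (S θ).card := Finset.sum_le_sum hsep
    _ = ∑ w, ((Finset.Icc 1 K).filter fun θ => θ ≤ d w ∧ d w < θ + c w).card := by
      simp only [S, Finset.card_filter]
      exact Finset.sum_comm
    _ ≤ ∑ w, c w := by
      refine Finset.sum_le_sum fun w _ => ?_
      -- The truncated subtraction is harmless because `θ ≥ 1`.
      calc _ ≤ (Finset.Ioc (d w - c w) (d w)).card := by
            refine Finset.card_le_card fun θ hθ => ?_
            simp only [Finset.mem_filter, Finset.mem_Icc, Finset.mem_Ioc] at hθ ⊢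
            omega
        _ ≤ c w := by rw [Nat.card_Ioc]; omega

/-! ### Counting the values taken by a system of maps -/

theorem card_le_card_edgeSet_add_one_of_reachable {β : Type*} [Finite β] (Γ : SimpleGraph β)
    (S : Finset β) (hS : ∀ a ∈ S, ∀ b ∈ S, Γ.Reachable a b) :
    S.card ≤ Γ.edgeSet.ncard + 1 := by
  rcases S.eq_empty_or_nonempty with rfl | ⟨a, ha⟩
  · simp
  let C := Γ.connectedComponentMk a
  have h := C.connected_toSimpleGraph.card_vert_le_card_edgeSet_add_one
  have h1 : S.card ≤ Nat.card C := by
    rw [← Set.ncard_coe_finset]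
    change _ ≤ Nat.card C.supp
    rw [Nat.card_coe_set_eq]
    refine Set.ncard_le_ncard (fun b hb => ?_) (Set.toFinite _)
    exact SimpleGraph.ConnectedComponent.sound (hS b hb a ha)
  have h2 : Nat.card C.toSimpleGraph.edgeSet ≤ Γ.edgeSet.ncard := by
    rw [← Nat.card_coe_set_eq]
    exact Nat.card_le_card_of_injective _
      (SimpleGraph.Hom.mapEdgeSet.injective C.toSimpleGraph_hom Subtype.val_injective)
  omega

theorem two_mul_card_image_le {ι β : Type*} [Fintype ι] [DecidableEq β] (φ : ι → β)
    (h : ∀ j, ∃ j', j' ≠ j ∧ φ j' = φ j) :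
    2 * (Finset.univ.image φ).card ≤ Fintype.card ι := by
  classical
  rw [← Finset.card_univ]
  refine Finset.mul_card_image_le_card _ 2 fun b hb => ?_
  obtain ⟨j, -, rfl⟩ := Finset.mem_image.1 hb
  obtain ⟨j', hne, heq⟩ := h j
  exact Finset.one_lt_card.2 ⟨j', by simp [heq], j, by simp, hne⟩

section Configuration

variable {α β : Type*} [DecidableEq β] {H : SimpleGraph α}
  {k : ℕ} {ρ : Fin k × Bool → α → β} {f : β → α} {U V : Set α}

theorem card_image_le_of_eq_false {w : α} (h : ∀ i, ∃ i', ρ (i, true) w = ρ (i', false) w) :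
    (Finset.univ.image fun j => ρ j w).card ≤ k := by
  have hsub : (Finset.univ.image fun j => ρ j w) ⊆
      Finset.univ.image fun i : Fin k => ρ (i, false) w := by
    intro b hb
    obtain ⟨⟨i, s⟩, -, rfl⟩ := Finset.mem_image.1 hb
    cases s
    · exact Finset.mem_image_of_mem (fun i : Fin k => ρ (i, false) w) (Finset.mem_univ i)
    · obtain ⟨i', hi'⟩ := h i
      exact Finset.mem_image.2 ⟨i', Finset.mem_univ _, hi'.symm⟩
  exact (Finset.card_le_card hsub).trans (Finset.card_image_le.trans (by simp))

theorem card_image_le_of_repeats {γ : Type*} [DecidableEq γ] {φ : Fin k × Bool → γ}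
    (h : ∀ j, ∃ j', j' ≠ j ∧ φ j' = φ j) : (Finset.univ.image φ).card ≤ k := by
  have := two_mul_card_image_le φ h
  simp only [Fintype.card_prod, Fintype.card_fin, Fintype.card_bool] at this
  omega

/-- The images of the path under all `2k` maps are glued into one connected graph: copies `(i,
false)` and `(i, true)` meet at the end in `V`, copies `(i, true)` and `(i + 1, false)` at the end
in `U`. Each path edge has at most `k` images, since every image is repeated. -/
theorem sum_card_image_path_le [DecidableEq α] [Finite β] (hf : ∀ j w, f (ρ j w) = w)
    (hrep : ∀ j a b, H.Adj a b → ∃ j', j' ≠ j ∧ ρ j' a = ρ j a ∧ ρ j' b = ρ j b)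
    (hV : ∀ i, ∀ b ∈ V, ρ (i, true) b = ρ (i, false) b)
    (hU : ∀ i i' : Fin k, i'.val = i.val + 1 → ∀ a ∈ U, ρ (i, true) a = ρ (i', false) a)
    {a b : α} (ha : a ∈ U) (hb : b ∈ V) (p : H.Walk a b) :
    ∑ w ∈ p.support.toFinset, (Finset.univ.image fun j => ρ j w).card ≤ k * p.length + 1 := by
  let E : Finset (Sym2 β) :=
    p.edges.toFinset.biUnion fun e => Finset.univ.image fun j => Sym2.map (ρ j) e
  let Γ : SimpleGraph β := SimpleGraph.fromEdgeSet E
  have hE : E.card ≤ k * p.length := by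
    calc E.card ≤ ∑ e ∈ p.edges.toFinset,
          (Finset.univ.image fun j => Sym2.map (ρ j) e).card := Finset.card_biUnion_le
      _ ≤ ∑ _e ∈ p.edges.toFinset, k := by
        refine Finset.sum_le_sum fun e he => card_image_le_of_repeats fun j => ?_
        have he' := p.edges_subset_edgeSet (List.mem_toFinset.1 he)
        induction e with
        | _ c d =>
          obtain ⟨j', hne, h1, h2⟩ := hrep j c d he'
          exact ⟨j', hne, by simp [h1, h2]⟩
      _ ≤ k * p.length := by
        rw [Finset.sum_const, smul_eq_mul, mul_comm, ← p.length_edges]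
        exact Nat.mul_le_mul_left _ (List.toFinset_card_le _)
  have hadj : ∀ j, ∀ c d, s(c, d) ∈ p.edges → Γ.Adj (ρ j c) (ρ j d) := by
    intro j c d hcd
    rw [SimpleGraph.fromEdgeSet_adj]
    refine ⟨?_, fun h => ?_⟩
    · simp only [E, Finset.coe_biUnion, Set.mem_iUnion, Finset.mem_coe, List.mem_toFinset]
      exact ⟨s(c, d), hcd, Finset.mem_image.2 ⟨j, Finset.mem_univ _, rfl⟩⟩
    · have hcd' : H.Adj c d := p.edges_subset_edgeSet hcd
      apply hcd'.ne
      rw [← hf j c, h, hf]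
  have hwalk : ∀ j, ∀ c d, ∀ r : H.Walk c d, r.edges ⊆ p.edges → ∀ w ∈ r.support,
      Γ.Reachable (ρ j c) (ρ j w) := by
    intro j c d r
    induction r with
    | nil => intro _ w hw; simp only [SimpleGraph.Walk.support_nil, List.mem_singleton] at hw; rw [hw]
    | cons hcd r ih =>
      intro hsub w hw
      rw [SimpleGraph.Walk.edges_cons, List.cons_subset] at hsub
      rw [SimpleGraph.Walk.support_cons, List.mem_cons] at hw
      rcases hw with rfl | hw
      · exact SimpleGraph.Reachable.refl _
      · exact (hadj j _ _ hsub.1).reachable.trans (ih hsub.2 w hw)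
  have hj : ∀ j, ∀ w ∈ p.support, Γ.Reachable (ρ j a) (ρ j w) := fun j =>
    hwalk j a b p (List.Subset.refl _)
  have htf : ∀ i, Γ.Reachable (ρ (i, false) a) (ρ (i, true) a) := by
    intro i
    have h1 := hj (i, false) b p.end_mem_support
    have h2 := hj (i, true) b p.end_mem_support
    rw [hV i b hb] at h2
    exact h1.trans h2.symm
  have hbase : ∀ m (hm : m < k), Γ.Reachable (ρ (⟨0, by omega⟩, false) a) (ρ (⟨m, hm⟩, false) a) := by
    intro m
    induction m with
    | zero => intro hm; exact SimpleGraph.Reachable.refl _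
    | succ m ih =>
      intro hm
      have h := htf ⟨m, by omega⟩
      rw [hU ⟨m, by omega⟩ ⟨m + 1, hm⟩ rfl a ha] at h
      exact (ih (by omega)).trans h
  have hall : ∀ j, ∀ j', Γ.Reachable (ρ j a) (ρ j' a) := by
    have h0 : ∀ i s, Γ.Reachable (ρ (⟨0, by have := i.2; omega⟩, false) a) (ρ (i, s) a) := by
      intro i s
      cases s
      · exact hbase i.1 i.2
      · exact (hbase i.1 i.2).trans (htf i)
    rintro ⟨i, s⟩ ⟨i', s'⟩
    exact (h0 i s).symm.trans (h0 i' s')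
  have hcard := card_le_card_edgeSet_add_one_of_reachable Γ
    (p.support.toFinset.biUnion fun w => Finset.univ.image fun j => ρ j w) (by
      intro c hc d hd
      simp only [Finset.mem_biUnion, List.mem_toFinset, Finset.mem_image, Finset.mem_univ,
        true_and] at hc hd
      obtain ⟨w, hw, j, rfl⟩ := hc
      obtain ⟨w', hw', j', rfl⟩ := hd
      exact (hj j w hw).symm.trans ((hall j j').trans (hj j' w' hw')))
  rw [Finset.card_biUnion] at hcard
  · have : Γ.edgeSet.ncard ≤ E.card := by
      rw [← Set.ncard_coe_finset]
      refine Set.ncard_le_ncard ?_ (Finset.finite_toSet E)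
      simp [Γ]
    omega
  -- The colouring `f` makes the value sets of different vertices disjoint, so their sizes add up.
  · intro w _ w' _ hne
    rw [Function.onFun, Finset.disjoint_left]
    intro c hc hc'
    simp only [Finset.mem_image, Finset.mem_univ, true_and] at hc hc'
    obtain ⟨j, rfl⟩ := hc
    obtain ⟨j', hj'⟩ := hc'
    apply hne
    rw [← hf j w, ← hj', hf]

theorem sum_card_image_add_le [Fintype α] [DecidableEq α] [Finite β] (hf : ∀ j w, f (ρ j w) = w)
    (hrep : ∀ j a b, H.Adj a b → ∃ j', j' ≠ j ∧ ρ j' a = ρ j a ∧ ρ j' b = ρ j b)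
    (hV : ∀ i, ∀ b ∈ V, ρ (i, true) b = ρ (i, false) b)
    (hU : ∀ i i' : Fin k, i'.val = i.val + 1 → ∀ a ∈ U, ρ (i, true) a = ρ (i', false) a)
    (hU' : ∀ i, ∃ i', ∀ a ∈ U, ρ (i, true) a = ρ (i', false) a)
    (hdeg : ∀ w, w ∉ U ∪ V → ∃ w', H.Adj w w') :
    ∑ w, (Finset.univ.image fun j => ρ j w).card + (k - 1) * minSeparator H U V ≤
      k * Fintype.card α := by
  have hle : ∀ w, (Finset.univ.image fun j => ρ j w).card ≤ k := by
    intro w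
    by_cases hw : w ∈ U ∪ V
    · refine card_image_le_of_eq_false fun i => ?_
      rcases hw with hw | hw
      · obtain ⟨i', hi'⟩ := hU' i
        exact ⟨i', hi' w hw⟩
      · exact ⟨i, hV i w hw⟩
    · obtain ⟨w', hww'⟩ := hdeg w hw
      refine card_image_le_of_repeats fun j => ?_
      obtain ⟨j', hne, h, -⟩ := hrep j w w' hww'
      exact ⟨j', hne, h⟩
  have hsplit : ∀ T : Finset α, ∑ w ∈ T, (Finset.univ.image fun j => ρ j w).card +
      ∑ w ∈ T, (k - (Finset.univ.image fun j => ρ j w).card) = k * T.card := by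
    intro T
    rw [← Finset.sum_add_distrib, Finset.sum_congr rfl fun w _ => Nat.add_sub_of_le (hle w)]
    simp [mul_comm]
  -- The weights are the deficits. A path with `ℓ` edges has `ℓ + 1` vertices, so its total deficit
  -- is at least `k (ℓ + 1) - (k ℓ + 1) = k - 1`.
  have hsep := mul_minSeparator_le H U V
    (fun w => k - (Finset.univ.image fun j => ρ j w).card) (k - 1) (by
      intro a ha b hb p hp
      have h1 := sum_card_image_path_le hf hrep hV hU ha hb p
      have h2 := hsplit p.support.toFinset
      rw [List.toFinset_card_of_nodup hp.support_nodup, SimpleGraph.Walk.length_support,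
        mul_add] at h2
      omega)
  have h := hsplit Finset.univ
  rw [Finset.card_univ] at h
  omega

end Configuration

/-! ### Colour coding -/

/-- `π` sends `u` to `A` and `v` to `B`, and `f` is a left inverse of `π`. -/
def ColoredMatch {α : Type*} {x y n : ℕ} (u : Fin x ↪ α) (v : Fin y ↪ α) (f : Fin n → α)
    (A : Idx n x) (B : Idx n y) (π : α ↪ Fin n) : Prop :=
  (∀ i, π (u i) = A.elem i) ∧ (∀ j, π (v j) = B.elem j) ∧ ∀ w, f (π w) = w

open Classical in
/-- The part of `R` coming from the maps `π` that have the colouring `f` as a left inverse. -/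
noncomputable def coloredR {α : Type*} [Fintype α] [DecidableEq α] (H : SimpleGraph α)
    [DecidableRel H.Adj] {x y : ℕ} (u : Fin x ↪ α) (v : Fin y ↪ α) {n : ℕ} (f : Fin n → α)
    (G : SimpleGraph (Fin n)) : Matrix (Idx n x) (Idx n y) ℝ :=
  Matrix.of fun A B => ∑ π : α ↪ Fin n with ColoredMatch u v f A B π, chi G (mapEdges H π)

section Coloring

variable {α : Type*} [Fintype α] [DecidableEq α] (H : SimpleGraph α) [DecidableRel H.Adj]
  {x y n : ℕ} (u : Fin x ↪ α) (v : Fin y ↪ α)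

/-- The colour is forced on the image of `π` and free elsewhere. -/
theorem card_leftInverse (π : α ↪ Fin n) :
    (Finset.univ.filter fun f : Fin n → α => ∀ w, f (π w) = w).card =
      Fintype.card α ^ (n - Fintype.card α) := by
  let s : Fin n → Finset α := fun c => Finset.univ.filter fun w => ∀ w', π w' = c → w = w'
  have hs : (Finset.univ.filter fun f : Fin n → α => ∀ w, f (π w) = w) = Fintype.piFinset s := by
    ext f
    simp only [Finset.mem_filter, Finset.mem_univ, true_and, Fintype.mem_piFinset, s]
    exact ⟨fun h c w' hc => hc ▸ h w', fun h w => h _ w rfl⟩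
  have hcard : ∀ c, (s c).card = if c ∈ Finset.univ.image π then 1 else Fintype.card α := by
    intro c
    split_ifs with hc
    · obtain ⟨w, -, rfl⟩ := Finset.mem_image.1 hc
      rw [Finset.card_eq_one]
      refine ⟨w, ?_⟩
      ext w'
      simp [s]
    · rw [← Finset.card_univ]
      congr 1
      ext w
      simp only [Finset.mem_filter, Finset.mem_univ, true_and, iff_true, s]
      intro w' hw'
      exact absurd (Finset.mem_image.2 ⟨w', Finset.mem_univ _, hw'⟩) hc
  rw [hs, Fintype.card_piFinset, Finset.prod_congr rfl fun c _ => hcard c, Finset.prod_ite,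
    Finset.prod_const_one, one_mul, Finset.prod_const, Finset.filter_not, Finset.filter_mem_eq_inter,
    Finset.univ_inter, ← Finset.compl_eq_univ_sdiff, Finset.card_compl,
    Finset.card_image_of_injective _ π.injective, Finset.card_univ, Fintype.card_fin]

theorem sum_coloredR (G : SimpleGraph (Fin n)) :
    ∑ f : Fin n → α, coloredR H u v f G =
      ((Fintype.card α : ℝ) ^ (n - Fintype.card α)) • R H u v G := by
  ext A B
  simp only [Matrix.sum_apply, coloredR, R, Matrix.of_apply, Matrix.smul_apply, smul_eq_mul,
    Finset.sum_filter, Finset.mul_sum]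
  rw [Finset.sum_comm]
  refine Finset.sum_congr rfl fun π _ => ?_
  by_cases h : (∀ i, π (u i) = A.elem i) ∧ ∀ j, π (v j) = B.elem j
  · have hiff : ∀ f, ColoredMatch u v f A B π ↔ ∀ w, f (π w) = w := fun f =>
      ⟨fun h' => h'.2.2, fun h' => ⟨h.1, h.2, h'⟩⟩
    rw [if_pos h, ← Nat.cast_pow, ← card_leftInverse π, Finset.card_filter, Nat.cast_sum,
      Finset.sum_mul]
    refine Finset.sum_congr rfl fun f _ => ?_
    by_cases hf : ∀ w, f (π w) = w
    · rw [if_pos ((hiff f).2 hf), if_pos hf, Nat.cast_one, one_mul]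
    · rw [if_neg fun h' => hf ((hiff f).1 h'), if_neg hf, Nat.cast_zero, zero_mul]
  · rw [if_neg h, mul_zero]
    refine Finset.sum_eq_zero fun f _ => ?_
    rw [if_neg fun h' : ColoredMatch u v f A B π => h ⟨h'.1, h'.2.1⟩]

/-- A fixed injection is compatible with a fraction `t ^ (-t)` of all `t ^ n` colourings, so `R` is
`t ^ t` times the average of its coloured parts; the triangle inequality and the power mean
inequality give the bound. -/
theorem norm_R_pow_le [Nonempty α] (G : SimpleGraph (Fin n)) (m : ℕ) :
    ‖R H u v G‖ ^ (m + 1) * (Fintype.card α : ℝ) ^ n ≤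
      ((Fintype.card α : ℝ) ^ Fintype.card α) ^ (m + 1) *
        ∑ f : Fin n → α, ‖coloredR H u v f G‖ ^ (m + 1) := by
  -- For `n < t` the exponent `n - t` is truncated, but then no injection exists and `R = 0`.
  rcases lt_or_ge n (Fintype.card α) with hn | hn
  · have hR : R H u v G = 0 := by
      ext A B
      have : IsEmpty (α ↪ Fin n) := Function.Embedding.isEmpty_of_card_lt (by simpa using hn)
      simp [R]
    rw [hR, norm_zero, zero_pow (Nat.succ_ne_zero m), zero_mul]
    positivity
  set t := Fintype.card α with ht
  have ht0 : (0 : ℝ) < t := by exact_mod_cast Fintype.card_pos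
  have h1 : ‖R H u v G‖ * (t : ℝ) ^ n ≤ (t : ℝ) ^ t * ∑ f : Fin n → α, ‖coloredR H u v f G‖ := by
    have h := norm_sum_le Finset.univ fun f : Fin n → α => coloredR H u v f G
    rw [sum_coloredR, norm_smul, Real.norm_of_nonneg (by positivity)] at h
    calc _ = (t : ℝ) ^ t * ((t : ℝ) ^ (n - t) * ‖R H u v G‖) := by
          rw [← mul_assoc, ← pow_add, Nat.add_sub_of_le hn, mul_comm]
      _ ≤ _ := by gcongr
  have h2 := pow_sum_div_card_le_sum_pow (s := Finset.univ)
    (f := fun f : Fin n → α => ‖coloredR H u v f G‖) (fun _ _ => norm_nonneg _) m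
  rw [Finset.card_univ, Fintype.card_fun, Fintype.card_fin, ← ht, Nat.cast_pow,
    div_le_iff₀ (by positivity)] at h2
  have h3 := pow_le_pow_left₀ (by positivity) h1 (m + 1)
  rw [mul_pow, mul_pow] at h3
  refine le_of_mul_le_mul_right ?_ (show (0 : ℝ) < ((t : ℝ) ^ n) ^ m by positivity)
  calc _ = ‖R H u v G‖ ^ (m + 1) * ((t : ℝ) ^ n) ^ (m + 1) := by ring
    _ ≤ _ := h3
    _ ≤ ((t : ℝ) ^ t) ^ (m + 1) * _ := mul_le_mul_of_nonneg_left h2 (by positivity)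
    _ = _ := by ring

end Coloring

/-! ### Cancellation by toggling an edge -/

section Flip

variable {n : ℕ}

/-- Toggle the edge `e` of `G`. -/
def flip (e : Sym2 (Fin n)) (G : SimpleGraph (Fin n)) : SimpleGraph (Fin n) :=
  SimpleGraph.fromEdgeSet (symmDiff G.edgeSet {e})

theorem edgeSet_flip {e : Sym2 (Fin n)} (he : ¬ e.IsDiag) (G : SimpleGraph (Fin n)) :
    (flip e G).edgeSet = symmDiff G.edgeSet {e} := by
  rw [flip, SimpleGraph.edgeSet_fromEdgeSet]
  refine sdiff_eq_left.2 (Set.disjoint_left.2 fun e' h hd => ?_)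
  rcases h with h | h
  · exact G.not_isDiag_of_mem_edgeSet h.1 hd
  · exact he (h.1 ▸ hd)

theorem flip_involutive {e : Sym2 (Fin n)} (he : ¬ e.IsDiag) :
    Function.Involutive (flip e) := by
  intro G
  apply SimpleGraph.edgeSet_injective
  rw [edgeSet_flip he, edgeSet_flip he, symmDiff_assoc, symmDiff_self]
  exact symmDiff_bot _

theorem edgeVar_flip {e : Sym2 (Fin n)} (he : ¬ e.IsDiag) (G : SimpleGraph (Fin n))
    (e' : Sym2 (Fin n)) :
    edgeVar (flip e G) e' = (if e' = e then -1 else 1) * edgeVar G e' := by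
  have : e' ∈ (flip e G).edgeSet ↔ ((e' ∈ G.edgeSet ∧ e' ≠ e) ∨ (e' = e ∧ e' ∉ G.edgeSet)) := by
    rw [edgeSet_flip he, Set.mem_symmDiff]; rfl
  unfold edgeVar
  by_cases h1 : e' = e
  · subst h1
    by_cases h2 : e' ∈ G.edgeSet <;> simp [this, h2]
  · by_cases h2 : e' ∈ G.edgeSet <;> simp [this, h1, h2]

theorem chi_flip {e : Sym2 (Fin n)} (he : ¬ e.IsDiag) (G : SimpleGraph (Fin n))
    (E : Finset (Sym2 (Fin n))) :
    chi (flip e G) E = (if e ∈ E then -1 else 1) * chi G E := by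
  simp only [chi, edgeVar_flip he, Finset.prod_mul_distrib]
  simp [Finset.prod_ite_eq']

/-- Toggling `e` is an involution on graphs that changes the sign of exactly one factor. -/
theorem sum_prod_chi_eq_zero {ι : Type*} [Fintype ι] {e : Sym2 (Fin n)} (he : ¬ e.IsDiag)
    (E : ι → Finset (Sym2 (Fin n))) (j : ι) (hj : ∀ i, e ∈ E i ↔ i = j) :
    ∑ G : SimpleGraph (Fin n), ∏ i, chi G (E i) = 0 := by
  classical
  have h : ∀ G : SimpleGraph (Fin n), ∏ i, chi (flip e G) (E i) = -∏ i, chi G (E i) := by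
    intro G
    simp only [chi_flip he, Finset.prod_mul_distrib, hj]
    simp
  have h2 : ∑ G : SimpleGraph (Fin n), ∏ i, chi G (E i) = -∑ G, ∏ i, chi G (E i) := by
    rw [← Finset.sum_neg_distrib, ← Equiv.sum_comp (flip_involutive he).toPerm]
    simp [h]
  linarith

theorem abs_chi (G : SimpleGraph (Fin n)) (E : Finset (Sym2 (Fin n))) : |chi G E| = 1 := by
  rw [chi, Finset.abs_prod]
  refine Finset.prod_eq_one fun e _ => ?_
  unfold edgeVar
  split_ifs <;> simp

end Flip

/-! ### Expansion of the trace and its surviving terms -/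

section Trace

variable {α : Type*} {x y n k : ℕ}

theorem Idx.elem_injective {n x : ℕ} : Function.Injective (Idx.elem : Idx n x → Fin x → Fin n) := by
  intro A A' h
  apply Subtype.ext
  apply Finset.coe_injective
  rw [← Finset.range_orderEmbOfFin A.1 A.2, ← Finset.range_orderEmbOfFin A'.1 A'.2]
  exact congrArg Set.range h

/-- The maps occurring in a term of the expanded trace: two for each of the `k` factors. -/
def maps (τ : Fin k → Idx n y × (α ↪ Fin n) × (α ↪ Fin n)) (j : Fin k × Bool) : α ↪ Fin n :=
  bif j.2 then (τ j.1).2.2 else (τ j.1).2.1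

/-- The index set of the nonzero terms in the expansion of `tr ((M * Mᵀ) ^ k)`, for `M` the matrix
`coloredR`: a closed sequence of row indices, and for each of its steps a column index and a pair
of matching maps. -/
def IsConfig (u : Fin x ↪ α) (v : Fin y ↪ α) (f : Fin n → α)
    (c : (Fin (k + 1) → Idx n x) × (Fin k → Idx n y × (α ↪ Fin n) × (α ↪ Fin n))) : Prop :=
  c.1 0 = c.1 (Fin.last k) ∧
    ∀ i, ColoredMatch u v f (c.1 i.castSucc) (c.2 i).1 (c.2 i).2.1 ∧
      ColoredMatch u v f (c.1 i.succ) (c.2 i).1 (c.2 i).2.2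

variable {u : Fin x ↪ α} {v : Fin y ↪ α} {f : Fin n → α}
  {c : (Fin (k + 1) → Idx n x) × (Fin k → Idx n y × (α ↪ Fin n) × (α ↪ Fin n))}

theorem IsConfig.leftInverse (hc : IsConfig u v f c) (j : Fin k × Bool) (w : α) :
    f (maps c.2 j w) = w := by
  obtain ⟨i, s⟩ := j
  cases s
  · exact (hc.2 i).1.2.2 w
  · exact (hc.2 i).2.2.2 w

theorem IsConfig.maps_eq_of_mem_range_right (hc : IsConfig u v f c) (i : Fin k) :
    ∀ b ∈ Set.range v, maps c.2 (i, true) b = maps c.2 (i, false) b := by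
  rintro _ ⟨j, rfl⟩
  exact ((hc.2 i).2.2.1 j).trans ((hc.2 i).1.2.1 j).symm

theorem IsConfig.maps_eq_of_mem_range_left (hc : IsConfig u v f c) {i i' : Fin k}
    (hi : c.1 i.succ = c.1 i'.castSucc) :
    ∀ a ∈ Set.range u, maps c.2 (i, true) a = maps c.2 (i', false) a := by
  rintro _ ⟨j, rfl⟩
  refine ((hc.2 i).2.1 j).trans (Eq.trans ?_ ((hc.2 i').1.1 j).symm)
  rw [hi]

theorem IsConfig.exists_succ_eq_castSucc (hc : IsConfig u v f c) (i : Fin k) :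
    ∃ i' : Fin k, c.1 i.succ = c.1 i'.castSucc := by
  by_cases h : i.val + 1 < k
  · exact ⟨⟨i.val + 1, h⟩, congrArg c.1 (Fin.ext rfl)⟩
  · have hk : i.val + 1 = k := by have := i.2; omega
    refine ⟨⟨0, by omega⟩, ?_⟩
    have h1 : i.succ = Fin.last k := Fin.ext hk
    rw [h1, ← hc.1]
    exact congrArg c.1 (Fin.ext rfl)

/-- The values of the maps of a configuration at all positions that are not determined by
others. -/
def values (u : Fin x ↪ α) (v : Fin y ↪ α)
    (c : (Fin (k + 1) → Idx n x) × (Fin k → Idx n y × (α ↪ Fin n) × (α ↪ Fin n))) :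
    α × Fin k ⊕ {w // w ∉ Set.range u ∪ Set.range v} × Fin k → Fin n :=
  Sum.elim (fun s => maps c.2 (s.2, false) s.1) fun s => maps c.2 (s.2, true) s.1

/-- The `false` maps are recorded in full and determine all row and column indices; the last row
index equals the first, which needs `k ≠ 0`. The indices in turn determine the `true` maps on `U`
and `V`, so only their values outside have to be recorded. -/
theorem values_injOn (hk : k ≠ 0) :
    Set.InjOn (values (n := n) (k := k) u v) {c | IsConfig u v f c} := by
  rintro ⟨p, τ⟩ hc ⟨p', τ'⟩ hc' heq
  have h1 : ∀ i, (τ i).2.1 = (τ' i).2.1 := fun i =>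
    Function.Embedding.ext fun w => congrFun heq (Sum.inl (w, i))
  have h2 : ∀ i (w : {w // w ∉ Set.range u ∪ Set.range v}), (τ i).2.2 w = (τ' i).2.2 w :=
    fun i w => congrFun heq (Sum.inr (w, i))
  have hp : ∀ i : Fin k, p i.castSucc = p' i.castSucc := by
    intro i
    apply Idx.elem_injective
    funext j
    rw [← (hc.2 i).1.1 j, ← (hc'.2 i).1.1 j]
    exact congrArg (fun π : α ↪ Fin n => π (u j)) (h1 i)
  have hB : ∀ i : Fin k, (τ i).1 = (τ' i).1 := by
    intro i
    apply Idx.elem_injective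
    funext j
    rw [← (hc.2 i).1.2.1 j, ← (hc'.2 i).1.2.1 j]
    exact congrArg (fun π : α ↪ Fin n => π (v j)) (h1 i)
  have hpp : p = p' := by
    funext i
    induction i using Fin.lastCases with
    | last =>
      have e1 : p 0 = p (Fin.last k) := hc.1
      have e2 : p' 0 = p' (Fin.last k) := hc'.1
      rw [← e1, ← e2]
      exact hp ⟨0, Nat.pos_of_ne_zero hk⟩
    | cast i => exact hp i
  have hτ : τ = τ' := by
    funext i
    refine Prod.ext (hB i) (Prod.ext (h1 i) (Function.Embedding.ext fun w => ?_))
    by_cases hw : w ∈ Set.range u ∪ Set.range v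
    · rcases hw with ⟨j, rfl⟩ | ⟨j, rfl⟩
      · have e1 := (hc.2 i).2.1 j
        have e2 := (hc'.2 i).2.1 j
        dsimp only at e1 e2
        rw [e1, e2, hpp]
      · have e1 := (hc.2 i).2.2.1 j
        have e2 := (hc'.2 i).2.2.1 j
        dsimp only at e1 e2
        rw [e1, e2, hB]
    · exact h2 i ⟨w, hw⟩
  rw [hpp, hτ]

variable [Fintype α] [DecidableEq α] (H : SimpleGraph α) [DecidableRel H.Adj]

open Classical in
theorem trace_coloredR_pow (G : SimpleGraph (Fin n)) :
    ((coloredR H u v f G * (coloredR H u v f G).transpose) ^ k).trace =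
      ∑ c : (Fin (k + 1) → Idx n x) × (Fin k → Idx n y × (α ↪ Fin n) × (α ↪ Fin n))
        with IsConfig u v f c, ∏ j, chi G (mapEdges H (maps c.2 j)) := by
  have hentry : ∀ A A', (coloredR H u v f G * (coloredR H u v f G).transpose) A A' =
      ∑ s : Idx n y × (α ↪ Fin n) × (α ↪ Fin n),
        if ColoredMatch u v f A s.1 s.2.1 ∧ ColoredMatch u v f A' s.1 s.2.2 then
          chi G (mapEdges H s.2.1) * chi G (mapEdges H s.2.2) else 0 := by
    intro A A'
    rw [Matrix.mul_apply, Fintype.sum_prod_type]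
    refine Finset.sum_congr rfl fun B _ => ?_
    rw [Matrix.transpose_apply, Fintype.sum_prod_type]
    simp only [coloredR, Matrix.of_apply, Finset.sum_filter, Finset.sum_mul_sum]
    refine Finset.sum_congr rfl fun π _ => Finset.sum_congr rfl fun π' _ => ?_
    by_cases h1 : ColoredMatch u v f A B π <;> by_cases h2 : ColoredMatch u v f A' B π' <;>
      simp [h1, h2]
  rw [trace_pow_eq_sum_closed_path, Finset.sum_filter, Finset.sum_filter, Fintype.sum_prod_type]
  refine Finset.sum_congr rfl fun p _ => ?_
  simp only [hentry, Finset.prod_univ_sum, Fintype.piFinset_univ, Finset.prod_ite_zero]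
  by_cases h : p 0 = p (Fin.last k)
  · rw [if_pos h]
    refine Finset.sum_congr rfl fun τ _ => ?_
    simp only [IsConfig, h, true_and, Finset.mem_univ, forall_true_left]
    refine if_congr Iff.rfl ?_ rfl
    rw [Fintype.prod_prod_type]
    refine Finset.prod_congr rfl fun i _ => ?_
    rw [Fintype.prod_bool, mul_comm]
    rfl
  · simp [IsConfig, h]

variable {H} in
theorem IsConfig.repeats (hc : IsConfig u v f c)
    (hne : ∑ G : SimpleGraph (Fin n), ∏ j, chi G (mapEdges H (maps c.2 j)) ≠ 0)
    (j : Fin k × Bool) (a b : α) (hab : H.Adj a b) :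
    ∃ j', j' ≠ j ∧ maps c.2 j' a = maps c.2 j a ∧ maps c.2 j' b = maps c.2 j b := by
  by_contra! hcon
  apply hne
  refine sum_prod_chi_eq_zero (e := s(maps c.2 j a, maps c.2 j b)) ?_ _ j fun j' => ?_
  · simpa using hab.ne
  constructor
  · intro hmem
    simp only [mapEdges, Finset.mem_image, SimpleGraph.mem_edgeFinset] at hmem
    obtain ⟨e, he, heq⟩ := hmem
    -- Applying `f` to the common image shows that the edge of `H` below it is `ab` itself; the
    -- swapped orientation is excluded in the same way.
    have hfe : Sym2.map f (Sym2.map (maps c.2 j') e) = e := by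
      rw [Sym2.map_map]
      have : f ∘ (maps c.2 j') = id := funext fun w => hc.leftInverse j' w
      rw [this, Sym2.map_id, id]
    rw [heq, Sym2.map_mk] at hfe
    simp only [hc.leftInverse] at hfe
    rw [← hfe, Sym2.map_mk, Sym2.eq_iff] at heq
    by_contra hj
    rcases heq with ⟨h1, h2⟩ | ⟨h1, h2⟩
    · exact hcon j' hj h1 h2
    · apply hab.ne
      rw [← hc.leftInverse j' a, h1, hc.leftInverse]
  · rintro rfl
    simp only [mapEdges, Finset.mem_image, SimpleGraph.mem_edgeFinset]
    exact ⟨s(a, b), hab, rfl⟩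

theorem card_image_values_le (c) :
    (Finset.univ.image (values (n := n) (k := k) u v c)).card ≤
      ∑ w, (Finset.univ.image fun j => maps c.2 j w).card := by
  refine le_trans (Finset.card_le_card fun b hb => ?_)
    (Finset.card_biUnion_le (s := Finset.univ)
      (t := fun w => Finset.univ.image fun j => maps c.2 j w))
  simp only [Finset.mem_image, Finset.mem_univ, true_and, Finset.mem_biUnion] at hb ⊢
  obtain ⟨⟨w, i⟩ | ⟨w, i⟩, rfl⟩ := hb
  · exact ⟨w, (i, false), rfl⟩
  · exact ⟨w, (i, true), rfl⟩

/-- A surviving term is encoded by `k (t + z)` recorded values, of which at most `kt - (k - 1) q`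
are distinct. The shortfall is `(k - 1) q + kz`, the `m` of `card_image_card_add_le`; each term has
absolute value at most `1` for every graph. -/
theorem sum_norm_coloredR_pow_le (hdeg : ∀ w, w ∉ Set.range u ∪ Set.range v → 1 ≤ H.degree w)
    (hk : k ≠ 0) {z q : ℕ} (hz : z = (Set.range u ∪ Set.range v)ᶜ.ncard)
    (hq : q = minSeparator H (Set.range u) (Set.range v)) :
    ∑ G : SimpleGraph (Fin n), ‖coloredR H u v f G‖ ^ (2 * k) ≤
      (Fintype.card (SimpleGraph (Fin n)) : ℝ) *
        (((k * (Fintype.card α + z)) ^ (2 * ((k - 1) * q + k * z)) *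
          n ^ (k * (Fintype.card α + z) - ((k - 1) * q + k * z)) : ℕ) : ℝ) := by
  classical
  let good := Finset.univ.filter
    fun c : (Fin (k + 1) → Idx n x) × (Fin k → Idx n y × (α ↪ Fin n) × (α ↪ Fin n)) =>
      IsConfig u v f c ∧ ∑ G : SimpleGraph (Fin n), ∏ j, chi G (mapEdges H (maps c.2 j)) ≠ 0
  have hcardσ : Fintype.card (α × Fin k ⊕ {w // w ∉ Set.range u ∪ Set.range v} × Fin k) =
      k * (Fintype.card α + z) := by
    have : Fintype.card {w // w ∉ Set.range u ∪ Set.range v} = z := by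
      rw [hz, ← Nat.card_coe_set_eq, Nat.card_eq_fintype_card]
      exact Fintype.card_congr (Equiv.refl _)
    rw [Fintype.card_sum, Fintype.card_prod, Fintype.card_prod, this, Fintype.card_fin]
    ring
  have hgood : good.card ≤ (k * (Fintype.card α + z)) ^ (2 * ((k - 1) * q + k * z)) *
      n ^ (k * (Fintype.card α + z) - ((k - 1) * q + k * z)) := by
    have hcount := card_image_card_add_le
      (σ := α × Fin k ⊕ {w // w ∉ Set.range u ∪ Set.range v} × Fin k) (β := Fin n)
      ((k - 1) * q + k * z)
    rw [hcardσ, Fintype.card_fin] at hcount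
    refine le_trans (Finset.card_le_card_of_injOn (values u v) (fun c hc => ?_) ?_) hcount
    · simp only [good, Finset.coe_filter, Finset.mem_univ, true_and, Set.mem_ofPred_eq] at hc ⊢
      obtain ⟨hc, hne⟩ := hc
      have h1 := sum_card_image_add_le (ρ := fun j => maps c.2 j) (f := f) (H := H)
        (U := Set.range u) (V := Set.range v) hc.leftInverse
        (hc.repeats hne) hc.maps_eq_of_mem_range_right
        (fun i i' hi => hc.maps_eq_of_mem_range_left (congrArg c.1 (Fin.ext hi.symm)))
        (fun i => (hc.exists_succ_eq_castSucc i).imp fun i' hi' =>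
          hc.maps_eq_of_mem_range_left hi')
        (fun w hw => (H.degree_pos_iff_exists_adj w).1 (hdeg w hw))
      have h2 := card_image_values_le (u := u) (v := v) c
      rw [← hq] at h1
      rw [mul_add]
      omega
    · intro c hc c' hc' h
      simp only [good, Finset.coe_filter, Finset.mem_univ, true_and, Set.mem_ofPred_eq] at hc hc'
      exact values_injOn (f := f) hk hc.1 hc'.1 h
  calc ∑ G : SimpleGraph (Fin n), ‖coloredR H u v f G‖ ^ (2 * k)
      ≤ ∑ G : SimpleGraph (Fin n),
          ((coloredR H u v f G * (coloredR H u v f G).transpose) ^ k).trace :=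
        Finset.sum_le_sum fun G _ => norm_pow_two_mul_le_trace _ hk
    _ = ∑ c : (Fin (k + 1) → Idx n x) × (Fin k → Idx n y × (α ↪ Fin n) × (α ↪ Fin n))
          with IsConfig u v f c,
          ∑ G : SimpleGraph (Fin n), ∏ j, chi G (mapEdges H (maps c.2 j)) := by
        simp only [trace_coloredR_pow]
        exact Finset.sum_comm
    _ = ∑ c ∈ good, ∑ G : SimpleGraph (Fin n), ∏ j, chi G (mapEdges H (maps c.2 j)) := by
        rw [← Finset.sum_filter_ne_zero, Finset.filter_filter]
    _ ≤ ∑ _c ∈ good, (Fintype.card (SimpleGraph (Fin n)) : ℝ) := by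
        refine Finset.sum_le_sum fun c _ => ?_
        calc _ ≤ ∑ _G : SimpleGraph (Fin n), (1 : ℝ) := by
              refine Finset.sum_le_sum fun G _ => (le_abs_self _).trans ?_
              simp [Finset.abs_prod, abs_chi]
          _ = _ := by simp
    _ ≤ _ := by
        rw [Finset.sum_const, nsmul_eq_mul, mul_comm]
        exact mul_le_mul_of_nonneg_left (by exact_mod_cast hgood) (by positivity)

end Trace

/-! ### The uniform measure on graphs and Markov's inequality -/

theorem minSeparator_le_card {α : Type*} [Fintype α] (H : SimpleGraph α) (U V : Set α) :
    minSeparator H U V ≤ Fintype.card α :=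
  Nat.sInf_le ⟨Finset.univ, fun a _ _ _ p _ => ⟨a, Finset.mem_univ a, p.start_mem_support⟩, rfl⟩

open Classical in
theorem binomialRandom_half_real {n : ℕ} (S : Set (SimpleGraph (Fin n))) :
    (SimpleGraph.binomialRandom (Fin n) half).real S * Fintype.card (SimpleGraph (Fin n)) =
      (Finset.univ.filter (· ∈ S)).card := by
  set μ := SimpleGraph.binomialRandom (Fin n) half with hμ
  have hsing : ∀ G : SimpleGraph (Fin n), μ.real {G} = (1 / 2 : ℝ) ^ n.choose 2 := by
    intro G
    have hle : G.edgeSet.ncard ≤ n.choose 2 := by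
      have := G.card_edgeFinset_le_card_choose_two
      rw [Fintype.card_fin] at this
      rwa [← SimpleGraph.coe_edgeFinset, Set.ncard_coe_finset]
    rw [MeasureTheory.measureReal_def, hμ, SimpleGraph.binomialRandom_singleton]
    have h1 : ((unitInterval.toNNReal half : NNReal) : ℝ) = 1 / 2 := rfl
    have h2 : ((unitInterval.toNNReal (unitInterval.symm half) : NNReal) : ℝ) = 1 / 2 := by
      change (1 : ℝ) - 1 / 2 = 1 / 2
      norm_num
    simp only [ENNReal.toReal_mul, ENNReal.toReal_pow, ENNReal.coe_toReal, h1, h2,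
      Nat.card_eq_fintype_card, Fintype.card_fin]
    rw [← pow_add, Nat.add_sub_of_le hle]
  have : MeasurableSingletonClass (SimpleGraph (Fin n)) :=
    ⟨fun G => SimpleGraph.measurableEmbedding_edgeSet.measurableSet_image.1 (by
      rw [Set.image_singleton]
      exact MeasurableSet.singleton _)⟩
  have hS : ∀ T : Finset (SimpleGraph (Fin n)), μ.real T = T.card * (1 / 2 : ℝ) ^ n.choose 2 := by
    intro T
    rw [← MeasureTheory.sum_measureReal_singleton, Finset.sum_congr rfl fun G _ => hsing G]
    simp
  -- Total mass `1` gives the normalisation without counting the graphs on `[n]`.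
  have h1 := hS Finset.univ
  rw [Finset.coe_univ, MeasureTheory.probReal_univ, Finset.card_univ] at h1
  have h2 := hS (Finset.univ.filter (· ∈ S))
  have h3 : ((Finset.univ.filter (· ∈ S) : Finset (SimpleGraph (Fin n))) :
      Set (SimpleGraph (Fin n))) = S := by ext; simp
  rw [h3] at h2
  rw [h2, mul_assoc, mul_comm ((1 / 2 : ℝ) ^ _), ← h1, mul_one]

theorem binomialRandom_half_real_le {n : ℕ} (F : SimpleGraph (Fin n) → ℝ) (hF : ∀ G, 0 ≤ F G)
    {B ε : ℝ} (hB : 0 < B) (m : ℕ)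
    (h : ∑ G, F G ^ m ≤ Fintype.card (SimpleGraph (Fin n)) * (ε * B ^ m)) :
    (SimpleGraph.binomialRandom (Fin n) half).real {G | F G ≥ B} ≤ ε := by
  classical
  have hN : (0 : ℝ) < Fintype.card (SimpleGraph (Fin n)) := by exact_mod_cast Fintype.card_pos
  refine le_of_mul_le_mul_right ?_ hN
  rw [binomialRandom_half_real]
  refine le_of_mul_le_mul_right ?_ (pow_pos hB m)
  calc _ = ∑ _G : SimpleGraph (Fin n) with _G ∈ {G | F G ≥ B}, B ^ m := by simp
    _ ≤ ∑ G : SimpleGraph (Fin n) with G ∈ {G | F G ≥ B}, F G ^ m := by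
      refine Finset.sum_le_sum fun G hG => ?_
      have hG' : B ≤ F G := (Finset.mem_filter.1 hG).2
      gcongr
    _ ≤ ∑ G, F G ^ m := Finset.sum_le_sum_of_subset_of_nonneg (Finset.subset_univ _)
      fun G _ _ => pow_nonneg (hF G) m
    _ ≤ _ := h
    _ = _ := by ring

/-! ### The Frobenius bound and the moments of the full matrix -/

theorem norm_sq_le_card_mul_card {I J : Type*} [Fintype I] [DecidableEq I] [Fintype J]
    [DecidableEq J] (A : Matrix I J ℝ) (hA : ∀ i j, |A i j| ≤ 1) :
    ‖A‖ ^ 2 ≤ Fintype.card I * Fintype.card J := by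
  have h := norm_pow_two_mul_le_trace A one_ne_zero
  rw [mul_one, pow_one] at h
  refine h.trans ?_
  simp only [Matrix.trace, Matrix.diag, Matrix.mul_apply, Matrix.transpose_apply]
  calc _ ≤ ∑ _i : I, ∑ _j : J, (1 : ℝ) := by
        refine Finset.sum_le_sum fun i _ => Finset.sum_le_sum fun j _ => ?_
        rw [← abs_mul_abs_self]
        exact mul_le_one₀ (hA i j) (abs_nonneg _) (hA i j)
    _ = _ := by simp

theorem card_idx_le (n x : ℕ) : Fintype.card (Idx n x) ≤ n ^ x := by
  rw [Fintype.card_finset_len, Fintype.card_fin]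
  exact Nat.choose_le_pow n x

section

variable {α : Type*} [Fintype α] [DecidableEq α] (H : SimpleGraph α) [DecidableRel H.Adj]
  {x y : ℕ} (u : Fin x ↪ α) (v : Fin y ↪ α) {n : ℕ}

/-- With no vertex outside `U ∪ V`, an entry determines its map, so its sum has at most one term. -/
theorem abs_R_le_one (h : Set.range u ∪ Set.range v = Set.univ) (G : SimpleGraph (Fin n))
    (A : Idx n x) (B : Idx n y) : |R H u v G A B| ≤ 1 := by
  rw [R, Matrix.of_apply]
  refine (Finset.abs_sum_le_sum_abs _ _).trans ?_
  simp only [abs_chi, Finset.sum_const, nsmul_eq_mul, mul_one]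
  rw [Nat.cast_le_one, Finset.card_le_one]
  intro π hπ π' hπ'
  simp only [Finset.mem_filter, Finset.mem_univ, true_and] at hπ hπ'
  refine Function.Embedding.ext fun w => ?_
  have hw : w ∈ Set.range u ∪ Set.range v := h ▸ Set.mem_univ w
  rcases hw with ⟨i, rfl⟩ | ⟨j, rfl⟩
  · rw [hπ.1, hπ'.1]
  · rw [hπ.2, hπ'.2]

theorem norm_R_le_of_union_eq_univ (hUV : Disjoint (Set.range u) (Set.range v))
    (h : Set.range u ∪ Set.range v = Set.univ) (G : SimpleGraph (Fin n)) :
    ‖R H u v G‖ ≤ (n : ℝ) ^ ((Fintype.card α : ℝ) / 2) := by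
  have ht : Fintype.card α = x + y := by
    have h1 : (Set.range u ∪ Set.range v).ncard = x + y := by
      rw [Set.ncard_union_eq hUV]
      simp [Set.ncard_range_of_injective u.injective, Set.ncard_range_of_injective v.injective]
    rw [h, Set.ncard_univ, Nat.card_eq_fintype_card] at h1
    exact h1
  have hsq : ‖R H u v G‖ ^ 2 ≤ (n : ℝ) ^ Fintype.card α := by
    refine (norm_sq_le_card_mul_card _ (abs_R_le_one H u v h G)).trans ?_
    rw [ht, pow_add]
    exact_mod_cast Nat.mul_le_mul (card_idx_le n x) (card_idx_le n y)
  refine le_of_pow_le_pow_left₀ two_ne_zero (by positivity) (hsq.trans (le_of_eq ?_))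
  rw [← Real.rpow_natCast _ 2, ← Real.rpow_mul n.cast_nonneg, Nat.cast_ofNat,
    div_mul_cancel₀ _ two_ne_zero, Real.rpow_natCast]

theorem sum_norm_R_pow_le [Nonempty α]
    (hdeg : ∀ w, w ∉ Set.range u ∪ Set.range v → 1 ≤ H.degree w)
    {k : ℕ} (hk : k ≠ 0) {z q : ℕ} (hz : z = (Set.range u ∪ Set.range v)ᶜ.ncard)
    (hq : q = minSeparator H (Set.range u) (Set.range v)) :
    ∑ G : SimpleGraph (Fin n), ‖R H u v G‖ ^ (2 * k) ≤
      (Fintype.card (SimpleGraph (Fin n)) : ℝ) *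
        (((Fintype.card α : ℝ) ^ Fintype.card α) ^ (2 * k) *
          (((k * (Fintype.card α + z)) ^ (2 * ((k - 1) * q + k * z)) *
            n ^ (k * (Fintype.card α + z) - ((k - 1) * q + k * z)) : ℕ) : ℝ)) := by
  have ht0 : (0 : ℝ) < Fintype.card α := by exact_mod_cast Fintype.card_pos
  obtain ⟨m, hm⟩ : ∃ m, 2 * k = m + 1 := ⟨2 * k - 1, by omega⟩
  set W : ℝ := (((k * (Fintype.card α + z)) ^ (2 * ((k - 1) * q + k * z)) *
            n ^ (k * (Fintype.card α + z) - ((k - 1) * q + k * z)) : ℕ) : ℝ)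
  set t := Fintype.card α with ht
  refine le_of_mul_le_mul_right ?_ (show (0 : ℝ) < (t : ℝ) ^ n by positivity)
  calc _ = ∑ G : SimpleGraph (Fin n), ‖R H u v G‖ ^ (2 * k) * (t : ℝ) ^ n := Finset.sum_mul ..
    _ ≤ ∑ G : SimpleGraph (Fin n), ((t : ℝ) ^ t) ^ (2 * k) *
        ∑ f : Fin n → α, ‖coloredR H u v f G‖ ^ (2 * k) := by
      rw [hm]
      exact Finset.sum_le_sum fun G _ => norm_R_pow_le H u v G m
    _ = ((t : ℝ) ^ t) ^ (2 * k) *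
        ∑ f : Fin n → α, ∑ G : SimpleGraph (Fin n), ‖coloredR H u v f G‖ ^ (2 * k) := by
      rw [← Finset.mul_sum, Finset.sum_comm]
    _ ≤ ((t : ℝ) ^ t) ^ (2 * k) *
        ∑ _f : Fin n → α, (Fintype.card (SimpleGraph (Fin n)) : ℝ) * W := by
      refine mul_le_mul_of_nonneg_left (Finset.sum_le_sum fun f _ => ?_) (by positivity)
      exact sum_norm_coloredR_pow_le H hdeg hk hz hq
    _ = _ := by
      rw [Finset.sum_const, Finset.card_univ, Fintype.card_fun, Fintype.card_fin, nsmul_eq_mul,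
        Nat.cast_pow]
      ring

end

/-! ### Choice of the moment -/

theorem moment_bound_le {t z q n k : ℕ} (hn : 1 ≤ n) (ht : 1 ≤ t)
    (hqt : q ≤ t) (hk : k ≠ 0) {ε L : ℝ} (hε : 0 < ε) (hkL : (k : ℝ) ≤ L)
    (hLk : Real.log ((n : ℝ) ^ q / ε) ≤ k * (2 * ((q : ℝ) + z))) :
    ((t : ℝ) ^ t) ^ (2 * k) * (((k * (t + z)) ^ (2 * ((k - 1) * q + k * z)) *
        n ^ (k * (t + z) - ((k - 1) * q + k * z)) : ℕ) : ℝ) ≤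
      ε * (2 * (t : ℝ) ^ t * (Real.exp 1 * ((t : ℝ) + z) * L) ^ (q + z) *
        (n : ℝ) ^ (((t : ℝ) - q) / 2)) ^ (2 * k) := by
  have hn0 : (0 : ℝ) < n := by exact_mod_cast hn
  have ht0 : (0 : ℝ) < t := by exact_mod_cast ht
  have hk1 : 1 ≤ k := Nat.one_le_iff_ne_zero.2 hk
  have hk0 : (0 : ℝ) < k := by exact_mod_cast hk1
  set M : ℝ := (k : ℝ) * (t + z) with hM
  have hM1 : 1 ≤ M := by
    have : 1 ≤ k * (t + z) := Nat.one_le_iff_ne_zero.2 (Nat.mul_ne_zero hk (by omega))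
    rw [hM]; exact_mod_cast this
  -- The powers of `e` in the final bound serve to absorb the surplus factor `n ^ q / ε` left by the
  -- count.
  have hexp : (n : ℝ) ^ q ≤ ε * (Real.exp 1 ^ (q + z)) ^ (2 * k) := by
    rw [← div_le_iff₀' hε, ← Real.log_le_log_iff (by positivity) (by positivity), Real.log_pow,
      Real.log_pow, Real.log_exp]
    refine hLk.trans (le_of_eq ?_)
    push_cast
    ring
  have hnpow : (n : ℝ) ^ (k * (t + z) - ((k - 1) * q + k * z)) =
      (n : ℝ) ^ q * ((n : ℝ) ^ (((t : ℝ) - q) / 2)) ^ (2 * k) := by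
    have hexpo : k * (t + z) - ((k - 1) * q + k * z) = q + (t - q) * k := by
      obtain ⟨k, rfl⟩ : ∃ k', k = k' + 1 := ⟨k - 1, by omega⟩
      obtain ⟨d, rfl⟩ := Nat.exists_eq_add_of_le hqt
      rw [Nat.add_sub_cancel, Nat.add_sub_cancel_left]
      refine Nat.sub_eq_of_eq_add ?_
      ring
    rw [hexpo, pow_add, ← Real.rpow_natCast ((n : ℝ) ^ (((t : ℝ) - q) / 2)), ← Real.rpow_mul hn0.le,
      ← Real.rpow_natCast (n : ℝ) ((t - q) * k)]
    congr 2
    rw [Nat.cast_mul, Nat.cast_sub hqt]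
    push_cast
    ring
  have hMpow : M ^ (2 * ((k - 1) * q + k * z)) ≤ (M ^ (q + z)) ^ (2 * k) := by
    rw [← pow_mul]
    refine pow_le_pow_right₀ hM1 ?_
    have : (k - 1) * q ≤ k * q := Nat.mul_le_mul_right _ (Nat.sub_le _ _)
    nlinarith
  have hML : M ≤ ((t : ℝ) + z) * L := by
    rw [hM, mul_comm]
    gcongr
  -- The factor `2` in the stated bound is slack.
  have hone : (1 : ℝ) ≤ 2 ^ (2 * k) := one_le_pow₀ (by norm_num)
  push_cast
  rw [hnpow, ← hM]
  calc ((t : ℝ) ^ t) ^ (2 * k) * (M ^ (2 * ((k - 1) * q + k * z)) *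
        ((n : ℝ) ^ q * ((n : ℝ) ^ (((t : ℝ) - q) / 2)) ^ (2 * k)))
      ≤ ((t : ℝ) ^ t) ^ (2 * k) * (((((t : ℝ) + z) * L) ^ (q + z)) ^ (2 * k) *
        ((ε * (Real.exp 1 ^ (q + z)) ^ (2 * k)) *
          ((n : ℝ) ^ (((t : ℝ) - q) / 2)) ^ (2 * k))) := by
        have hL0 : 0 ≤ L := hk0.le.trans hkL
        have : M ^ (2 * ((k - 1) * q + k * z)) ≤ ((((t : ℝ) + z) * L) ^ (q + z)) ^ (2 * k) :=
          hMpow.trans (by gcongr)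
        gcongr
    _ = 1 * (ε * ((t : ℝ) ^ t * (Real.exp 1 * ((t : ℝ) + z) * L) ^ (q + z) *
        (n : ℝ) ^ (((t : ℝ) - q) / 2)) ^ (2 * k)) := by
        rw [mul_assoc (Real.exp 1), mul_pow (Real.exp 1)]
        simp only [mul_pow]
        ring
    _ ≤ 2 ^ (2 * k) * (ε * ((t : ℝ) ^ t * (Real.exp 1 * ((t : ℝ) + z) * L) ^ (q + z) *
        (n : ℝ) ^ (((t : ℝ) - q) / 2)) ^ (2 * k)) := by
        gcongr
        have : 0 ≤ L := hk0.le.trans hkL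
        positivity
    _ = _ := by
        rw [mul_left_comm, ← mul_pow]
        congr 2
        ring

end GraphMatrix

theorem theorem1 {α : Type*} [Fintype α] [DecidableEq α] (H : SimpleGraph α) [DecidableRel H.Adj]
    {x y : ℕ} (u : Fin x ↪ α) (v : Fin y ↪ α)
    (hUV : Disjoint (Set.range u) (Set.range v))
    (hdeg : ∀ w, w ∉ Set.range u ∪ Set.range v → 1 ≤ H.degree w)
    (t z q : ℕ) (ht : t = Fintype.card α)
    (hz : z = (Set.range u ∪ Set.range v)ᶜ.ncard)
    (hq : q = GraphMatrix.minSeparator H (Set.range u) (Set.range v))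
    (n : ℕ) :
    (1 ≤ q + z → 1 ≤ n → ∀ ε : ℝ, 0 < ε → ε < 1 →
      (SimpleGraph.binomialRandom (Fin n) GraphMatrix.half).real
        {G | ‖GraphMatrix.R H u v G‖ ≥
          2 * (t : ℝ) ^ t *
            (Real.exp 1 * ((t : ℝ) + z) *
              (Real.log (8 * (n : ℝ) ^ q / ε) / (2 * ((q : ℝ) + z)) + 1)) ^ (q + z) *
            (n : ℝ) ^ (((t : ℝ) - q) / 2)} ≤ ε) ∧
    (q = 0 ∧ z = 0 → ∀ G : SimpleGraph (Fin n),
      ‖GraphMatrix.R H u v G‖ ≤ (n : ℝ) ^ ((t : ℝ) / 2)) := by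
  have hqt : q ≤ t := by
    rw [hq, ht]
    exact GraphMatrix.minSeparator_le_card H _ _
  have hzt : z ≤ t := by
    rw [hz, ht, ← Nat.card_eq_fintype_card, ← Set.ncard_univ]
    exact Set.ncard_le_ncard (Set.subset_univ _) (Set.toFinite _)
  constructor
  · intro hqz hn ε hε hε1
    have ht1 : 1 ≤ t := by omega
    have hα : Nonempty α := Fintype.card_pos_iff.1 (ht ▸ ht1)
    have hn1 : (1 : ℝ) ≤ n := by exact_mod_cast hn
    have hqz0 : (0 : ℝ) < 2 * ((q : ℝ) + z) := by
      have : (1 : ℝ) ≤ (q : ℝ) + z := by exact_mod_cast hqz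
      linarith
    have hlog : 0 < Real.log ((n : ℝ) ^ q / ε) :=
      Real.log_pos ((one_lt_div hε).2 (hε1.trans_le (one_le_pow₀ hn1)))
    -- The least `k` with `exp (2k (q + z)) ≥ n ^ q / ε`; it is positive because `ε < 1 ≤ n ^ q`.
    set k := ⌈Real.log ((n : ℝ) ^ q / ε) / (2 * ((q : ℝ) + z))⌉₊ with hkdef
    have hk : k ≠ 0 := (Nat.ceil_pos.2 (div_pos hlog hqz0)).ne'
    have hk0 : (0 : ℝ) < k := by exact_mod_cast Nat.pos_of_ne_zero hk
    have hkL : (k : ℝ) ≤ Real.log (8 * (n : ℝ) ^ q / ε) / (2 * ((q : ℝ) + z)) + 1 := by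
      refine (Nat.ceil_lt_add_one (div_pos hlog hqz0).le).le.trans ?_
      -- The constant `8` in the stated logarithm is slack; the `+ 1` pays for rounding up.
      have : (n : ℝ) ^ q ≤ 8 * (n : ℝ) ^ q := le_mul_of_one_le_left (by positivity) (by norm_num)
      gcongr
    have hLk : Real.log ((n : ℝ) ^ q / ε) ≤ k * (2 * ((q : ℝ) + z)) :=
      (div_le_iff₀ hqz0).1 (Nat.le_ceil _)
    refine GraphMatrix.binomialRandom_half_real_le (fun G => ‖GraphMatrix.R H u v G‖)
      (fun G => norm_nonneg _) ?_ (2 * k) ?_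
    · have := hk0.trans_le hkL
      positivity
    · refine (GraphMatrix.sum_norm_R_pow_le H u v hdeg hk hz hq).trans ?_
      rw [← ht]
      exact mul_le_mul_of_nonneg_left
        (GraphMatrix.moment_bound_le hn ht1 hqt hk hε hkL hLk) (by positivity)
  · rintro ⟨-, rfl⟩ G
    rw [ht]
    refine GraphMatrix.norm_R_le_of_union_eq_univ H u v hUV ?_ G
    rw [← Set.compl_empty_iff]
    exact (Set.ncard_eq_zero (Set.toFinite _)).1 hz.symm
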